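/- All spaces are Tychonoff. A subset $C$ of a space $X$ is regularly closed if $C=\overline{\operatorname{Int} C}$. A quasi $\kappa$-metric on $X$ is a function $\rho$ assigning a real number $\rho(x,C)\ge 0$ to each point $x\in X$ and each regularly closed set $C\subset X$, such that: (1) for every regularly closed $C$ there is a dense open subset $V$ of $X\setminus C$ such that, for all $x\in X$, $\rho(x,C)>0$ iff $x\in V$; (2) if $C\subset C'$ are regularly closed, then $\rho(x,C')\le\rho(x,C)$ for every $x\in X$; (3) for every regularly closed $C$ the function $x\mapsto\rho(x,C)$ is continuous; (4) $\rho\bigl(x,\overline{\bigcup_\alpha C_\alpha}\bigr)=\inf_\alpha\rho(x,C_\alpha)$ for every $x\in X$ and every non-empty increasing transfinite (i.e. indexed by a well-ordered set) family $\{C_\alpha\}$ of regularly closed subsets of $X$. It is regular if moreover (5) $\rho(x,C)\le\rho(x,C')+\sup_{y\in C'}\rho(y,C)$ for all $x\in X$ and all regularly closed $C,C'\subset X$, where the supremum is taken in $[0,\infty]$ (so that it is $0$ for $C'=\varnothing$). The space $X$ is called (regularly) quasi $\kappa$-metrizable if it admits a (regular) quasi $\kappa$-metric, and pseudocompact if every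 continuous function $X\to\mathbb R$ is bounded. **Theorem.** Let $X$ be a pseudocompact Tychonoff space and let $\beta X$ be its Čech–Stone compactification. If $X$ is quasi $\kappa$-metrizable, then $\beta X$ is quasi $\kappa$-metrizable. If $X$ is regularly quasi $\kappa$-metrizable, then $\beta X$ is regularly quasi $\kappa$-metrizable. -/

import Mathlib

open scoped NNReal ENNReal

universe u

/-- A set `C` is regularly closed if it is the closure of its interior. -/
def IsRegularlyClosed {X : Type u} [TopologicalSpace X] (C : Set X) : Prop :=
  closure (interior C) = C

/-- A quasi `κ`-metric on `X`: a non-negative real function `ρ x C` of a point `x` and a regularly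
closed set `C`. Only the values at regularly closed sets matter. -/
structure IsQuasiKappaMetric {X : Type u} [TopologicalSpace X] (ρ : X → Set X → ℝ≥0) : Prop where
  /-- The positivity set of `ρ · C` is a dense open subset of `X \ C`. -/
  pos_iff : ∀ C : Set X, IsRegularlyClosed C →
    ∃ V : Set X, IsOpen V ∧ V ⊆ Cᶜ ∧ Cᶜ ⊆ closure V ∧ ∀ x : X, 0 < ρ x C ↔ x ∈ V
  /-- `ρ` is antitone in the regularly closed set. -/
  anti : ∀ C C' : Set X, IsRegularlyClosed C → IsRegularlyClosed C' → C ⊆ C' →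
    ∀ x : X, ρ x C' ≤ ρ x C
  /-- `ρ` is continuous in the point. -/
  cont : ∀ C : Set X, IsRegularlyClosed C → Continuous fun x : X => ρ x C
  /-- Increasing transfinite families: non-empty families indexed by a well-ordered set. Every
  chain of subsets of `X` which is well-ordered by inclusion is indexed by a type in the universe
  of `X`, so larger index types would add nothing. -/
  iInf_eq : ∀ (ι : Type u) [LinearOrder ι] [WellFoundedLT ι] [Nonempty ι] (C : ι → Set X),
    (∀ i, IsRegularlyClosed (C i)) → Monotone C →
    ∀ x : X, ρ x (closure (⋃ i, C i)) = ⨅ i, ρ x (C i)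

/-- A regular quasi `κ`-metric. The supremum is taken in `[0, ∞]`, where it always exists
(it is `0` for empty `C'`). -/
structure IsRegularQuasiKappaMetric {X : Type u} [TopologicalSpace X] (ρ : X → Set X → ℝ≥0) : Prop
    extends IsQuasiKappaMetric ρ where
  le_add_iSup : ∀ C C' : Set X, IsRegularlyClosed C → IsRegularlyClosed C' → ∀ x : X,
    (ρ x C : ℝ≥0∞) ≤ (ρ x C' : ℝ≥0∞) + ⨆ y ∈ C', (ρ y C : ℝ≥0∞)

/-- `X` admits a quasi `κ`-metric. -/
def QuasiKappaMetrizable (X : Type u) [TopologicalSpace X] : Prop :=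
  ∃ ρ : X → Set X → ℝ≥0, IsQuasiKappaMetric ρ

/-- `X` admits a regular quasi `κ`-metric. -/
def RegularlyQuasiKappaMetrizable (X : Type u) [TopologicalSpace X] : Prop :=
  ∃ ρ : X → Set X → ℝ≥0, IsRegularQuasiKappaMetric ρ

/-- Every continuous real-valued function on `X` is bounded. (For Tychonoff spaces.) -/
def IsPseudocompact (X : Type u) [TopologicalSpace X] : Prop :=
  ∀ f : X → ℝ, Continuous f → ∃ M : ℝ, ∀ x : X, |f x| ≤ M

open Set Topology

/-! Pseudocompactness bounds each `ρ · C`, so for regularly closed `F ⊆ βX` the function `ρ · (F ∩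
X)` extends continuously to `βX`; the extension is `σ · F`. Regularly closed sets correspond well to
their traces on the dense subspace, and pointwise inequalities between continuous functions extend
by density. The delicate axiom is (4), since extension need not commute with infima. It does when
convergence is uniform, which Dini's theorem supplies (`IsQuasiKappaMetric.exists_le_add`). -/

/-- **Dini's theorem** on a pseudocompact space. -/
theorem IsPseudocompact.exists_le_add_of_antitone {X : Type u} [TopologicalSpace X]
    (hX : IsPseudocompact X) {f : ℕ → X → ℝ≥0} {g : X → ℝ≥0} (hf : ∀ n, Continuous (f n))
    (hg : Continuous g) (hanti : Antitone f) (hlim : ∀ x, g x = ⨅ n, f n x) {ε : ℝ≥0}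
    (hε : 0 < ε) : ∃ n, ∀ x, f n x ≤ g x + ε := by
  by_contra! H
  -- The supports are locally finite by pointwise convergence and monotonicity, so the sum is
  -- continuous. Where `f n` exceeds `g + ε`, the first `n` terms are each at least `ε / 2`, so the
  -- sum is unbounded.
  let p : ℕ → X → ℝ := fun n x => max 0 ((f n x : ℝ) - g x - ε / 2)
  have hε' : (0 : ℝ) < ε := hε
  have hp : ∀ n, Continuous (p n) := fun n => by
    have := hf n
    fun_prop
  have hloc : LocallyFinite fun n => Function.support (p n) := by
    intro x
    have hlt : (⨅ n, f n x) < g x + ε / 2 := by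
      rw [← hlim x]
      exact lt_add_of_pos_right _ (half_pos hε)
    obtain ⟨N, hN⟩ := exists_lt_of_ciInf_lt hlt
    refine ⟨{z | f N z < g z + ε / 2},
      (isOpen_lt (hf N) (hg.add continuous_const)).mem_nhds hN, ?_⟩
    refine (finite_lt_nat N).subset ?_
    rintro n ⟨z, hz, hzN⟩
    by_contra hn
    refine hz (max_eq_left ?_)
    have h1 : f n z ≤ f N z := hanti (not_lt.mp hn) z
    have h2 : f n z < g z + ε / 2 := h1.trans_lt hzN
    have h3 : (f n z : ℝ) < g z + ε / 2 := by exact_mod_cast h2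
    linarith
  obtain ⟨M, hM⟩ := hX (fun x => ∑ᶠ n, p n x) (continuous_finsum hp hloc)
  obtain ⟨n, hn⟩ := exists_nat_gt (M / (ε / 2))
  obtain ⟨x, hx⟩ := H n
  have hfin : (Function.support fun k => p k x).Finite := hloc.point_finite x
  have hle : ∑ k ∈ Finset.range n, p k x ≤ ∑ᶠ k, p k x := by
    rw [finsum_eq_sum_of_support_subset (s := hfin.toFinset ∪ Finset.range n) _
      fun k hk => by simpa using Or.inl hk]
    exact Finset.sum_le_sum_of_subset_of_nonneg Finset.subset_union_right
      fun k _ _ => le_max_left _ _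
  have hterm : ∀ k ∈ Finset.range n, (ε / 2 : ℝ) ≤ p k x := by
    intro k hk
    have h1 : f n x ≤ f k x := hanti (Finset.mem_range.mp hk).le x
    have h2 : (g x + ε : ℝ) < f k x := by exact_mod_cast hx.trans_le h1
    exact le_max_of_le_right (by linarith)
  have hsum := Finset.card_nsmul_le_sum _ _ _ hterm
  rw [Finset.card_range, nsmul_eq_mul] at hsum
  rw [div_lt_iff₀ (half_pos hε')] at hn
  have := (le_abs_self _).trans (hM x)
  linarith

theorem IsRegularlyClosed.isClosed {X : Type u} [TopologicalSpace X] {C : Set X}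
    (hC : IsRegularlyClosed C) : IsClosed C :=
  hC ▸ isClosed_closure

theorem IsRegularlyClosed.closure_iUnion {X : Type u} [TopologicalSpace X] {ι : Sort*}
    {C : ι → Set X} (hC : ∀ i, IsRegularlyClosed (C i)) :
    IsRegularlyClosed (closure (⋃ i, C i)) := by
  refine (closure_minimal interior_subset isClosed_closure).antisymm ?_
  refine closure_minimal (iUnion_subset fun i => ?_) isClosed_closure
  rw [← hC i]
  exact closure_mono (interior_mono ((subset_iUnion C i).trans subset_closure))

/-- On a pseudocompact space, a quasi `κ`-metric converges uniformly along increasing families of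
regularly closed sets. -/
theorem IsQuasiKappaMetric.exists_le_add {X : Type u} [TopologicalSpace X]
    (hX : IsPseudocompact X) {ρ : X → Set X → ℝ≥0} (hρ : IsQuasiKappaMetric ρ)
    {ι : Type u} [LinearOrder ι] [WellFoundedLT ι] [Nonempty ι] {C : ι → Set X}
    (hC : ∀ i, IsRegularlyClosed (C i)) (hmono : Monotone C) {ε : ℝ≥0} (hε : 0 < ε) :
    ∃ i, ∀ x, ρ x (C i) ≤ ρ x (closure (⋃ j, C j)) + ε := by
  obtain ⟨i, hi⟩ : ∃ i, ∀ j, i ≤ j → ∀ x, ρ x (C i) ≤ ρ x (C j) + ε := by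
    -- Otherwise there is an increasing sequence of indices along which `ρ` drops by more than `ε`
    -- somewhere at each step, against Dini for the union of that sequence.
    by_contra! H
    choose s hs x hx using H
    let a : ℕ → ι := fun n => s^[n] (Classical.arbitrary ι)
    have ha : ∀ n, a (n + 1) = s (a n) := fun n => Function.iterate_succ_apply' s n _
    have hamono : Monotone a := monotone_nat_of_le_succ fun n => (ha n).symm ▸ hs (a n)
    obtain ⟨n, hn⟩ := hX.exists_le_add_of_antitone (f := fun n x => ρ x (C (a n)))
      (g := fun x => ρ x (closure (⋃ n : ULift.{u} ℕ, C (a n.down))))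
      (fun n => hρ.cont _ (hC _))
      (hρ.cont _ (IsRegularlyClosed.closure_iUnion fun n => hC _))
      (fun m n hmn x => hρ.anti _ _ (hC _) (hC _) (hmono (hamono hmn)) x)
      (fun x => by
        rw [hρ.iInf_eq (ULift.{u} ℕ) (fun n => C (a n.down)) (fun n => hC _)
          (fun m n hmn => hmono (hamono hmn)) x]
        exact Equiv.ulift.iInf_congr fun _ => rfl) hε
    refine (hx (a n)).not_ge ((hn _).trans (add_le_add_left ?_ ε))
    refine hρ.anti _ _ (hC _) (IsRegularlyClosed.closure_iUnion fun n => hC _) ?_ _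
    rw [← ha n]
    exact (subset_iUnion (fun n : ULift.{u} ℕ => C (a n.down)) ⟨n + 1⟩).trans subset_closure
  refine ⟨i, fun x => ?_⟩
  rw [hρ.iInf_eq ι C hC hmono x, ← tsub_le_iff_right]
  refine le_ciInf fun j => tsub_le_iff_right.mpr ?_
  rcases le_total i j with h | h
  · exact hi j h x
  · exact (hρ.anti _ _ (hC _) (hC _) (hmono h) x).trans le_self_add

section DenseInducing

variable {X Y : Type u} [TopologicalSpace Y] {e : X → Y}

theorem IsRegularlyClosed.closure_image_preimage {F : Set Y} (hF : IsRegularlyClosed F)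
    (he : DenseRange e) : closure (e '' (e ⁻¹' F)) = F := by
  refine (closure_minimal (image_preimage_subset _ _) hF.isClosed).antisymm ?_
  calc F = closure (interior F) := hF.symm
    _ ⊆ closure (interior F ∩ range e) :=
      closure_minimal (he.open_subset_closure_inter isOpen_interior) isClosed_closure
    _ ⊆ closure (e '' (e ⁻¹' F)) := by
      rw [image_preimage_eq_inter_range]
      exact closure_mono (inter_subset_inter_left _ interior_subset)

variable [TopologicalSpace X]

theorem IsRegularlyClosed.preimage {F : Set Y} (hF : IsRegularlyClosed F)
    (he : IsDenseInducing e) : IsRegularlyClosed (e ⁻¹' F) := by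
  refine (closure_minimal interior_subset (hF.isClosed.preimage he.continuous)).antisymm ?_
  calc e ⁻¹' F = e ⁻¹' closure (interior F) := by rw [hF]
    _ ⊆ e ⁻¹' closure (e '' (e ⁻¹' interior F)) := by
      rw [image_preimage_eq_inter_range]
      exact preimage_mono (closure_minimal
        (he.dense.open_subset_closure_inter isOpen_interior) isClosed_closure)
    _ = closure (e ⁻¹' interior F) := (he.isInducing.closure_eq_preimage_closure_image _).symm
    _ ⊆ closure (interior (e ⁻¹' F)) :=
      closure_mono (preimage_interior_subset_interior_preimage he.continuous)

/-- Each `F i` is the closure of its trace on the range, so passing to traces does not change the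
closure of the union. -/
theorem preimage_closure_iUnion_of_isRegularlyClosed (he : IsDenseInducing e) {ι : Sort*}
    {F : ι → Set Y} (hF : ∀ i, IsRegularlyClosed (F i)) :
    e ⁻¹' closure (⋃ i, F i) = closure (⋃ i, e ⁻¹' F i) := by
  rw [he.isInducing.closure_eq_preimage_closure_image, image_iUnion]
  congr 1
  refine (closure_minimal (iUnion_subset fun i => ?_) isClosed_closure).antisymm
    (closure_mono (iUnion_mono fun i => image_preimage_subset _ _))
  rw [← (hF i).closure_image_preimage he.dense]
  exact closure_mono (subset_iUnion (fun i => e '' (e ⁻¹' F i)) i)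

/-- A continuous extension of a quasi `κ`-metric from a pseudocompact space to a space containing
it densely is a quasi `κ`-metric. -/
theorem IsQuasiKappaMetric.of_isDenseInducing (hX : IsPseudocompact X) (he : IsDenseInducing e)
    {ρ : X → Set X → ℝ≥0} (hρ : IsQuasiKappaMetric ρ) {σ : Y → Set Y → ℝ≥0}
    (hcont : ∀ F, IsRegularlyClosed F → Continuous fun y => σ y F)
    (hext : ∀ F, IsRegularlyClosed F → ∀ x, σ (e x) F = ρ x (e ⁻¹' F)) :
    IsQuasiKappaMetric σ := by
  have hanti : ∀ C C' : Set Y, IsRegularlyClosed C → IsRegularlyClosed C' → C ⊆ C' →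
      ∀ y, σ y C' ≤ σ y C := by
    intro C C' hC hC' hCC' y
    refine he.dense.induction_on y (isClosed_le (hcont _ hC') (hcont _ hC)) fun x => ?_
    rw [hext _ hC, hext _ hC']
    exact hρ.anti _ _ (hC.preimage he) (hC'.preimage he) (preimage_mono hCC') x
  refine ⟨fun F hF => ?_, hanti, hcont, fun ι _ _ _ F hF hmono y => ?_⟩
  · obtain ⟨V, -, hVsub, hVdense, hVpos⟩ := hρ.pos_iff _ (hF.preimage he)
    have hopen : IsOpen {y | 0 < σ y F} := isOpen_lt continuous_const (hcont F hF)
    refine ⟨{y | 0 < σ y F}, hopen, fun y hy hyF => ?_, ?_, fun y => Iff.rfl⟩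
    -- `σ · F` vanishes on the trace of `F`, which is dense in `F`.
    · have hzero : F ⊆ {y | σ y F ≤ 0} := by
        conv_lhs => rw [← hF.closure_image_preimage he.dense]
        refine closure_minimal ?_ (isClosed_le (hcont F hF) continuous_const)
        rintro _ ⟨x, hx, rfl⟩
        rw [mem_ofPred_eq, hext F hF, ← not_lt, hVpos]
        exact fun hxV => hVsub hxV hx
      have hle : σ y F ≤ 0 := hzero hyF
      have hpos : 0 < σ y F := hy
      exact hle.not_gt hpos
    · refine (he.dense.open_subset_closure_inter hF.isClosed.isOpen_compl).trans
        (closure_minimal ?_ isClosed_closure)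
      rintro _ ⟨hx, x, rfl⟩
      refine closure_mono ?_ (image_closure_subset_closure_image he.continuous
        (mem_image_of_mem e (hVdense hx)))
      rintro _ ⟨z, hz, rfl⟩
      rw [mem_ofPred_eq, hext F hF]
      exact (hVpos z).mpr hz
  · have hU := IsRegularlyClosed.closure_iUnion hF
    refine le_antisymm (le_ciInf fun i => hanti _ _ (hF i) hU
      ((subset_iUnion F i).trans subset_closure) y) (le_of_forall_pos_le_add fun ε hε => ?_)
    obtain ⟨i, hi⟩ := hρ.exists_le_add hX (fun i => (hF i).preimage he)
      (fun i j hij => preimage_mono (hmono hij)) hε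
    refine (ciInf_le (OrderBot.bddBelow _) i).trans ?_
    refine he.dense.induction_on y
      (isClosed_le (hcont _ (hF i)) ((hcont _ hU).add continuous_const)) fun x => ?_
    rw [hext _ (hF i), hext _ hU, preimage_closure_iUnion_of_isRegularlyClosed he hF]
    exact hi x

/-- A continuous extension of a regular quasi `κ`-metric from a pseudocompact space to a space
containing it densely is a regular quasi `κ`-metric. -/
theorem IsRegularQuasiKappaMetric.of_isDenseInducing (hX : IsPseudocompact X)
    (he : IsDenseInducing e) {ρ : X → Set X → ℝ≥0} (hρ : IsRegularQuasiKappaMetric ρ)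
    {σ : Y → Set Y → ℝ≥0} (hcont : ∀ F, IsRegularlyClosed F → Continuous fun y => σ y F)
    (hext : ∀ F, IsRegularlyClosed F → ∀ x, σ (e x) F = ρ x (e ⁻¹' F)) :
    IsRegularQuasiKappaMetric σ := by
  refine ⟨hρ.toIsQuasiKappaMetric.of_isDenseInducing hX he hcont hext, fun C C' hC hC' y => ?_⟩
  -- The supremum does not depend on `y`, so the inequality is a closed condition. On the range, the
  -- supremum over the trace of `C'` is at most that over `C'`.
  refine he.dense.induction_on y (isClosed_le (ENNReal.continuous_coe.comp (hcont _ hC))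
    ((ENNReal.continuous_coe.comp (hcont _ hC')).add continuous_const)) fun x => ?_
  simp only [hext _ hC x, hext _ hC' x]
  refine (hρ.le_add_iSup _ _ (hC.preimage he) (hC'.preimage he) x).trans
    (add_le_add_right (iSup₂_le fun z hz => ?_) _)
  rw [← hext _ hC]
  exact le_iSup₂ (f := fun y (_ : y ∈ C') => (σ y C : ℝ≥0∞)) (e z) hz

end DenseInducing

theorem IsPseudocompact.exists_stoneCech_extension {X : Type u} [TopologicalSpace X]
    (hX : IsPseudocompact X) {f : X → ℝ≥0} (hf : Continuous f) :
    ∃ g : StoneCech X → ℝ≥0, Continuous g ∧ ∀ x, g (stoneCechUnit x) = f x := by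
  obtain ⟨M, hM⟩ := hX (fun x => f x) (NNReal.continuous_coe.comp hf)
  have hmem : ∀ x, f x ∈ Icc 0 M.toNNReal := fun x =>
    ⟨zero_le, NNReal.le_toNNReal_of_coe_le ((le_abs_self _).trans (hM x))⟩
  have hf' : Continuous (fun x => (⟨f x, hmem x⟩ : Icc 0 M.toNNReal)) := hf.subtype_mk hmem
  exact ⟨fun y => (stoneCechExtend hf' y : Icc 0 M.toNNReal),
    continuous_subtype_val.comp (continuous_stoneCechExtend hf'),
    fun x => congrArg Subtype.val (stoneCechExtend_stoneCechUnit hf' x)⟩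

theorem IsQuasiKappaMetric.exists_stoneCech_extension {X : Type u} [TopologicalSpace X]
    [T35Space X] (hX : IsPseudocompact X) {ρ : X → Set X → ℝ≥0} (hρ : IsQuasiKappaMetric ρ) :
    ∃ σ : StoneCech X → Set (StoneCech X) → ℝ≥0,
      (∀ F, IsRegularlyClosed F → Continuous fun y => σ y F) ∧
      ∀ F, IsRegularlyClosed F → ∀ x, σ (stoneCechUnit x) F = ρ x (stoneCechUnit ⁻¹' F) := by
  have H : ∀ F : Set (StoneCech X), ∃ g : StoneCech X → ℝ≥0, IsRegularlyClosed F →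
      Continuous g ∧ ∀ x, g (stoneCechUnit x) = ρ x (stoneCechUnit ⁻¹' F) := by
    intro F
    by_cases hF : IsRegularlyClosed F
    · obtain ⟨g, hg⟩ := hX.exists_stoneCech_extension
        (hρ.cont _ (hF.preimage isDenseEmbedding_stoneCechUnit.isDenseInducing))
      exact ⟨g, fun _ => hg⟩
    · exact ⟨0, fun h => absurd h hF⟩
  choose g hg using H
  exact ⟨fun y F => g F y, fun F hF => (hg F hF).1, fun F hF => (hg F hF).2⟩

theorem theorem3p3 (X : Type u) [TopologicalSpace X] [T35Space X] (hX : IsPseudocompact X) :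
    (QuasiKappaMetrizable X → QuasiKappaMetrizable (StoneCech X)) ∧
    (RegularlyQuasiKappaMetrizable X → RegularlyQuasiKappaMetrizable (StoneCech X)) := by
  have he := (isDenseEmbedding_stoneCechUnit (X := X)).isDenseInducing
  constructor
  · rintro ⟨ρ, hρ⟩
    obtain ⟨σ, hcont, hext⟩ := hρ.exists_stoneCech_extension hX
    exact ⟨σ, hρ.of_isDenseInducing hX he hcont hext⟩
  · rintro ⟨ρ, hρ⟩
    obtain ⟨σ, hcont, hext⟩ := hρ.toIsQuasiKappaMetric.exists_stoneCech_extension hX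
    exact ⟨σ, hρ.of_isDenseInducing hX he hcont hext⟩
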